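/- Let $\Theta\subset\mathbb{R}$ be an open interval (possibly unbounded) and let $f(\cdot|\theta)$, $\theta\in\Theta$, be probability density (or mass) functions on $\mathbb{R}$, that is, densities with respect to a fixed measure $\nu$ on $\mathbb{R}$ (Lebesgue measure for densities, counting measure for mass functions), with a common support: the set $\mathcal{X}=\{x: f(x|\theta)>0\}$ does not depend on $\theta\in\Theta$. Let $\theta_0\in\Theta$, $n\ge 1$, and let $\boldsymbol{X}=(X_1,\ldots,X_n)$ be i.i.d. random variables with density $f(\cdot|\theta_0)$; $\mathbb{E}$ and $\mathrm{Var}$ refer to the true value $\theta_0$. For $\boldsymbol{x}=(x_1,\ldots,x_n)$ write $L(\theta;\boldsymbol{x})=\prod_{i=1}^n f(x_i|\theta)$ and $\ell(\theta;\boldsymbol{x})=\log L(\theta;\boldsymbol{x})$, and let $i(\theta)=\mathbb{E}_\theta\big[\big(\frac{\mathrm{d}}{\mathrm{d}\theta}\log f(X_1|\theta)\big)^2\big]$ be the expected Fisher information of one random variable. Assume that the maximum likelihood estimator $\hat\theta_n(\boldsymbol{X})$ exists and is unique: it is a random variable and, almost surely, $\hat\theta_n(\boldsymbol{X})$ is the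 unique maximiser of $\theta\mapsto L(\theta;\boldsymbol{X})$ over $\Theta$. Assume moreover: (R1) the densities defined by two different values of $\theta\in\Theta$ are distinct (not equal $\nu$-almost everywhere); (R2) for every $x$, $f(x|\theta)$ is three times differentiable in $\theta\in\Theta$ with continuous third derivative, and $\int f(x|\theta)\,\nu(\mathrm{d}x)$ can be differentiated three times under the integral sign on $\Theta$; (R3) $i(\theta_0)\neq 0$; (R.C.4$''$) the first three derivatives of $\theta\mapsto\ell(\theta;\boldsymbol{x})$ exist on $\Theta$ for all $\boldsymbol{x}\in\mathcal{X}^n$, and $M(\theta;\boldsymbol{x})$ is a function such that, for each $\boldsymbol{x}\in\mathcal{X}^n$, $\theta\mapsto M(\theta;\boldsymbol{x})$ is monotonic (increasing or decreasing) on $\Theta$ and $\big|\frac{\mathrm{d}^3}{\mathrm{d}\theta^3}\ell(\theta;\boldsymbol{x})\big|\le M(\theta;\boldsymbol{x})$ for all $\theta\in\Theta$, and such that $\mathbb{E}\big|(\hat\theta_n(\boldsymbol{X})-\theta_0)^2M(\tilde\theta;\boldsymbol{X})\big|<\infty$ both for $\tilde\theta=\theta_0$ and for $\tilde\theta=\hat\theta_n(\boldsymbol{X})$.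 Assume finally that $\mathbb{E}\big[\big|\frac{\mathrm{d}}{\mathrm{d}\theta}\log f(X_1|\theta_0)\big|^3\big]<\infty$, $\mathrm{Var}\big(\frac{\mathrm{d}^2}{\mathrm{d}\theta^2}\log f(X_1|\theta_0)\big)<\infty$ and $\mathbb{E}\big[(\hat\theta_n(\boldsymbol{X})-\theta_0)^2\big]<\infty$. Let $W=\sqrt{n\,i(\theta_0)}\,\big(\hat\theta_n(\boldsymbol{X})-\theta_0\big)$ and $Z\sim\mathrm{N}(0,1)$, and let $d_{\mathrm{W}}(W,Z)=\sup_h|\mathbb{E}[h(W)]-\mathbb{E}[h(Z)]|$, the supremum being over all $h:\mathbb{R}\to\mathbb{R}$ that are Lipschitz with constant at most $1$, be the $1$-Wasserstein distance. Then \begin{align*} d_{\mathrm{W}}(W,Z)\le\frac{1}{\sqrt{n}}\bigg\{&2+\frac{1}{[i(\theta_0)]^{3/2}}\,\mathbb{E}\bigg[\bigg|\frac{\mathrm{d}}{\mathrm{d}\theta}\log f(X_1|\theta_0)\bigg|^3\bigg]\\ &+\frac{1}{\sqrt{i(\theta_0)}}\sqrt{n\,\mathrm{Var}\bigg(\frac{\mathrm{d}^2}{\mathrm{d}\theta^2}\log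 f(X_1|\theta_0)\bigg)}\,\sqrt{\mathbb{E}\big[(\hat\theta_n(\boldsymbol{X})-\theta_0)^2\big]}\\ &+\frac{1}{2\sqrt{i(\theta_0)}}\Big(\mathbb{E}\big|(\hat\theta_n(\boldsymbol{X})-\theta_0)^2M(\theta_0;\boldsymbol{X})\big|+\mathbb{E}\big|(\hat\theta_n(\boldsymbol{X})-\theta_0)^2M(\hat\theta_n(\boldsymbol{X});\boldsymbol{X})\big|\Big)\bigg\}. \end{align*} -/

import Mathlib

open MeasureTheory ProbabilityTheory

namespace SingleParamMLE

noncomputable section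

/-- The `1`-Wasserstein distance between two laws on the real line, as an integral probability
metric: the supremum of `|E h(U) - E h(V)|` over all `h : ℝ → ℝ` with Lipschitz constant at most
`1`, where `U ~ μ` and `V ~ ν`.  It is meant for laws with finite first moment. -/
def wassersteinDist (μ ν : Measure ℝ) : ENNReal :=
  ⨆ (h : ℝ → ℝ) (_ : LipschitzWith 1 h), ENNReal.ofReal |(∫ x, h x ∂μ) - ∫ x, h x ∂ν|

/-- The law with density `x ↦ f θ x` with respect to the reference measure `ν`.
Lebesgue measure `ν = volume` gives probability density functions, and counting measure
`ν = Measure.count` gives probability mass functions. -/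
def law (ν : Measure ℝ) (f : ℝ → ℝ → ℝ) (θ : ℝ) : Measure ℝ :=
  ν.withDensity fun x => ENNReal.ofReal (f θ x)

/-- `f θ`, for `θ ∈ Θ`, is a family of probability densities with respect to `ν` with a common
support: where one of them is positive, all of them are, so that the log-likelihood of a sample
from the model is a real-valued function on all of `Θ`. -/
structure IsDensityFamily (ν : Measure ℝ) (Θ : Set ℝ) (f : ℝ → ℝ → ℝ) : Prop where
  measurable : ∀ θ ∈ Θ, Measurable (f θ)
  nonneg : ∀ θ ∈ Θ, ∀ x, 0 ≤ f θ x
  lintegral_eq_one : ∀ θ ∈ Θ, ∫⁻ x, ENNReal.ofReal (f θ x) ∂ν = 1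
  common_support : ∀ θ ∈ Θ, ∀ θ' ∈ Θ, ∀ x, 0 < f θ x → 0 < f θ' x

/-- (R1): two different parameter values define different densities (as elements of `L¹(ν)`,
that is, different laws). -/
def R1 (ν : Measure ℝ) (Θ : Set ℝ) (f : ℝ → ℝ → ℝ) : Prop :=
  ∀ θ ∈ Θ, ∀ θ' ∈ Θ, θ ≠ θ' → ¬ (f θ =ᵐ[ν] f θ')

/-- (R2): `θ ↦ f θ x` is three times differentiable on `Θ` with continuous third derivative, and
`∫ f θ x dν(x)` can be differentiated three times under the integral sign. -/
structure R2 (ν : Measure ℝ) (Θ : Set ℝ) (f : ℝ → ℝ → ℝ) : Prop where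
  contDiffOn : ∀ x, ContDiffOn ℝ 3 (fun t => f t x) Θ
  integrable : ∀ k ≤ 3, ∀ θ ∈ Θ, Integrable (fun x => iteratedDeriv k (fun t => f t x) θ) ν
  hasDerivAt : ∀ k < 3, ∀ θ ∈ Θ,
    HasDerivAt (fun s => ∫ x, iteratedDeriv k (fun t => f t x) s ∂ν)
      (∫ x, iteratedDeriv (k + 1) (fun t => f t x) θ ∂ν) θ

/-- The expected Fisher information `i(θ) = E_θ [(d/dθ log f(X₁|θ))²]` of one random variable. -/
def fisherInfo (ν : Measure ℝ) (f : ℝ → ℝ → ℝ) (θ : ℝ) : ℝ :=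
  ∫ x, (deriv (fun t => Real.log (f t x)) θ) ^ 2 ∂(law ν f θ)

/-- (R3): the expected Fisher information at the true value does not vanish. -/
def R3 (ν : Measure ℝ) (f : ℝ → ℝ → ℝ) (θ₀ : ℝ) : Prop :=
  fisherInfo ν f θ₀ ≠ 0

/-- The likelihood function `L(θ; x) = ∏ᵢ f(xᵢ|θ)`. -/
def likelihood {n : ℕ} (f : ℝ → ℝ → ℝ) (θ : ℝ) (x : Fin n → ℝ) : ℝ :=
  ∏ i, f θ (x i)

/-- The log-likelihood function `ℓ(θ; x) = log L(θ; x)`. -/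
def logLikelihood {n : ℕ} (f : ℝ → ℝ → ℝ) (θ : ℝ) (x : Fin n → ℝ) : ℝ :=
  Real.log (likelihood f θ x)

/-- The support of the data: the samples all of whose entries have positive density. -/
def dataSupport (n : ℕ) (f : ℝ → ℝ → ℝ) (θ₀ : ℝ) : Set (Fin n → ℝ) :=
  {x | ∀ i, 0 < f θ₀ (x i)}

/-- `t` is the unique maximiser over `Θ` of the likelihood of the sample `x`. -/
def IsUniqueMLE {n : ℕ} (Θ : Set ℝ) (f : ℝ → ℝ → ℝ) (x : Fin n → ℝ) (t : ℝ) : Prop :=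
  t ∈ Θ ∧ ∀ θ ∈ Θ, θ ≠ t → likelihood f θ x < likelihood f t x

/-- (R.C.4'') with dominating function `M`, for the estimator `est` and the data `X` on the
probability space `(Ω, P)`. -/
structure RC4'' {Ω : Type*} [MeasurableSpace Ω] (P : Measure Ω) {n : ℕ} (X : Fin n → Ω → ℝ)
    (Θ : Set ℝ) (f : ℝ → ℝ → ℝ) (θ₀ : ℝ) (est : (Fin n → ℝ) → ℝ)
    (M : ℝ → (Fin n → ℝ) → ℝ) : Prop where
  /-- The derivatives of the log-likelihood up to order three exist. -/
  differentiableOn : ∀ x ∈ dataSupport n f θ₀, ∀ k < 3,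
    DifferentiableOn ℝ (iteratedDeriv k fun t => logLikelihood f t x) Θ
  /-- For each fixed sample, `M` is monotonic (increasing or decreasing) in the parameter. -/
  monotonic : ∀ x ∈ dataSupport n f θ₀,
    MonotoneOn (fun θ => M θ x) Θ ∨ AntitoneOn (fun θ => M θ x) Θ
  abs_le : ∀ x ∈ dataSupport n f θ₀, ∀ θ ∈ Θ,
    |iteratedDeriv 3 (fun t => logLikelihood f t x) θ| ≤ M θ x
  integrable_true : Integrable
    (fun ω => (est (fun i => X i ω) - θ₀) ^ 2 * M θ₀ (fun i => X i ω)) P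
  integrable_est : Integrable
    (fun ω => (est (fun i => X i ω) - θ₀) ^ 2 * M (est fun i => X i ω) (fun i => X i ω)) P

end

end SingleParamMLE

/-! The estimator is compared with the normalised score, a sum of i.i.d. centred variables to which
a quantitative central limit theorem applies. Let A and B be the first and second derivatives of the
log-likelihood at θ₀, D the estimation error and I the Fisher information. The first derivative
vanishes at the maximiser, so A + D B is a Taylor remainder, at most D²/2 times a bound for the
third derivative between θ₀ and the estimator; monotonicity of M in the parameter reduces that bound
to the two endpoints (`abs_score_add_le`). Moreover √(nI) D − A/√(nI) = (D (B + nI) − (A + D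
B))/√(nI), and B has mean −nI by the second Bartlett identity. Cauchy–Schwarz on D (B + nI) gives
the variance term, and the remainder gives the terms in M. A 1-Lipschitz test function changes by no
more than this difference.

The remaining terms come from Stein's method. For 1-Lipschitz h, the solution F of F' − wF = h − E
h(Z) is bounded by 1 and has a 2-Lipschitz derivative; both facts follow once w F(w) is 1-Lipschitz
(`abs_mul_steinSol_sub_le`). That in turn rests on monotone data, for which w F(w) is decreasing by
the Mills ratio bound (`antitone_mul_steinSol`). Removing one summand Y from the sum then costs
E|Y|³ + 2 E[Y²] E|Y| (`abs_integral_mul_sub_le`), and adding these costs yields the third-moment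
term and the constant 2. -/

namespace SingleParamMLE

open Set Filter Topology

noncomputable section

/-! ### The Gaussian weight and its Mills ratio. -/

/-- The unnormalised standard Gaussian density. -/
def gaussWeight (x : ℝ) : ℝ := Real.exp (-(x ^ 2 / 2))

lemma gaussWeight_pos (x : ℝ) : 0 < gaussWeight x := Real.exp_pos _

lemma continuous_gaussWeight : Continuous gaussWeight := by
  unfold gaussWeight; fun_prop

lemma hasDerivAt_gaussWeight (x : ℝ) : HasDerivAt gaussWeight (-x * gaussWeight x) x := by
  have h : HasDerivAt (fun y : ℝ => -(y ^ 2 / 2)) (-x) x := by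
    have := (((hasDerivAt_id x).pow 2).div_const 2).neg
    refine this.congr_deriv ?_
    simp
  exact h.exp.congr_deriv (by unfold gaussWeight; ring)

lemma exp_mul_gaussWeight (w : ℝ) : Real.exp (w ^ 2 / 2) * gaussWeight w = 1 := by
  rw [gaussWeight, ← Real.exp_add]; simp

lemma integrable_gaussWeight : Integrable gaussWeight := by
  have := integrable_exp_neg_mul_sq (b := 1 / 2) (by norm_num)
  refine this.congr (ae_of_all _ fun x => ?_)
  simp only [gaussWeight]; congr 1; ring

lemma integrable_id_mul_gaussWeight : Integrable (fun x => x * gaussWeight x) := by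
  have := integrable_mul_exp_neg_mul_sq (b := 1 / 2) (by norm_num)
  refine this.congr (ae_of_all _ fun x => ?_)
  simp only [gaussWeight]; congr 2; ring

lemma tendsto_gaussWeight_atBot : Tendsto gaussWeight atBot (𝓝 0) := by
  unfold gaussWeight
  refine Real.tendsto_exp_atBot.comp (tendsto_neg_atTop_atBot.comp ?_)
  refine Tendsto.atTop_div_const (by norm_num) ?_
  have : (fun x : ℝ => x ^ 2) = fun x => |x| ^ 2 := by ext; simp
  rw [this]
  exact (tendsto_pow_atTop two_ne_zero).comp tendsto_abs_atBot_atTop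

lemma gaussWeight_neg (x : ℝ) : gaussWeight (-x) = gaussWeight x := by simp [gaussWeight]

lemma tendsto_gaussWeight_atTop : Tendsto gaussWeight atTop (𝓝 0) := by
  refine (tendsto_gaussWeight_atBot.comp tendsto_neg_atTop_atBot).congr fun x => ?_
  exact gaussWeight_neg x

/-- The lower bound on the Mills ratio of the standard Gaussian law. -/
lemma mul_gaussWeight_le_setIntegral_Ioi (w : ℝ) :
    w * gaussWeight w ≤ (1 + w ^ 2) * ∫ x in Ioi w, gaussWeight x := by
  have hpos : ∀ x : ℝ, 0 < 1 + x ^ 2 := fun x => by positivity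
  -- This function vanishes at infinity and its derivative stays below the weight, so integrating
  -- over the tail gives the bound.
  have hd : ∀ x ∈ Ici w, HasDerivAt (fun x => -(x / (1 + x ^ 2)) * gaussWeight x)
      ((1 - 2 / (1 + x ^ 2) ^ 2) * gaussWeight x) x := by
    intro x _
    have h1 : HasDerivAt (fun y : ℝ => 1 + y ^ 2) (2 * x) x := by
      have := ((hasDerivAt_id x).pow 2).const_add 1
      exact this.congr_deriv (by simp)
    have := (((hasDerivAt_id x).div h1 (hpos x).ne').neg).mul (hasDerivAt_gaussWeight x)
    refine this.congr_deriv ?_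
    have := (hpos x).ne'
    simp only [Pi.neg_apply, Pi.div_apply, id]
    field_simp
    ring
  have hint : IntegrableOn (fun x => (1 - 2 / (1 + x ^ 2) ^ 2) * gaussWeight x) (Ioi w) := by
    refine Integrable.integrableOn ?_
    -- Any uniform bound serves; the factor in fact lies between −1 and 1.
    refine Integrable.bdd_mul (c := 3) integrable_gaussWeight ?_ ?_
    · refine Continuous.aestronglyMeasurable ?_
      refine continuous_const.sub (continuous_const.div (by fun_prop) fun x => ?_)
      have := hpos x; positivity
    · refine ae_of_all _ fun x => ?_
      have h1 : (1:ℝ) ≤ (1 + x ^ 2) ^ 2 := by nlinarith [sq_nonneg x]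
      have h2 : 2 / (1 + x ^ 2) ^ 2 ≤ 2 := div_le_self (by norm_num) h1
      have h3 : 0 ≤ 2 / (1 + x ^ 2) ^ 2 := by positivity
      rw [Real.norm_eq_abs, abs_le]; constructor <;> linarith
  have hlim : Tendsto (fun x => -(x / (1 + x ^ 2)) * gaussWeight x) atTop (𝓝 0) := by
    refine squeeze_zero_norm (fun x => ?_) tendsto_gaussWeight_atTop
    rw [norm_mul, Real.norm_of_nonneg (gaussWeight_pos x).le]
    refine mul_le_of_le_one_left (gaussWeight_pos x).le ?_
    rw [norm_neg, norm_div, Real.norm_of_nonneg (hpos x).le, div_le_one (hpos x),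
      Real.norm_eq_abs, abs_le]
    constructor <;> nlinarith [sq_nonneg (x - 1), sq_nonneg (x + 1)]
  have heq := integral_Ioi_of_hasDerivAt_of_tendsto' hd hint hlim
  have hle : ∫ x in Ioi w, (1 - 2 / (1 + x ^ 2) ^ 2) * gaussWeight x
      ≤ ∫ x in Ioi w, gaussWeight x := by
    refine setIntegral_mono hint integrable_gaussWeight.integrableOn fun x => ?_
    refine mul_le_of_le_one_left (gaussWeight_pos x).le ?_
    have : 0 ≤ 2 / (1 + x ^ 2) ^ 2 := by positivity
    linarith
  rw [heq] at hle
  have := mul_le_mul_of_nonneg_left hle (hpos w).le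
  refine le_trans (le_of_eq ?_) this
  have := (hpos w).ne'
  field_simp
  ring

lemma neg_mul_gaussWeight_le_setIntegral_Iic (w : ℝ) :
    -w * gaussWeight w ≤ (1 + w ^ 2) * ∫ x in Iic w, gaussWeight x := by
  have h := mul_gaussWeight_le_setIntegral_Ioi (-w)
  have h2 := integral_comp_neg_Iic w gaussWeight
  simp only [gaussWeight_neg] at h2
  rw [← h2] at h
  simpa [gaussWeight_neg] using h

/-! ### Stein's equation with Lipschitz data. -/

/-- The solution of the Stein equation `F' w - w * F w = h w` for centred `h`. -/
def steinSol (h : ℝ → ℝ) (w : ℝ) : ℝ :=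
  Real.exp (w ^ 2 / 2) * ∫ x in Iic w, h x * gaussWeight x

lemma hasDerivAt_steinSol {h : ℝ → ℝ} (hc : Continuous h)
    (hi : Integrable fun x => h x * gaussWeight x) (w : ℝ) :
    HasDerivAt (steinSol h) (h w + w * steinSol h w) w := by
  have h1 : HasDerivAt (fun y : ℝ => Real.exp (y ^ 2 / 2)) (Real.exp (w ^ 2 / 2) * w) w := by
    have := (((hasDerivAt_id w).pow 2).div_const 2).exp
    exact this.congr_deriv (by simp)
  have hcont : Continuous fun x => h x * gaussWeight x := hc.mul continuous_gaussWeight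
  have h2 : HasDerivAt (fun y => ∫ x in Iic y, h x * gaussWeight x) (h w * gaussWeight w) w := by
    have h3 : (fun y => ∫ x in Iic y, h x * gaussWeight x) =
        fun y => (∫ x in Iic w, h x * gaussWeight x) + ∫ x in w..y, h x * gaussWeight x := by
      ext y
      rw [← intervalIntegral.integral_Iic_sub_Iic hi.integrableOn hi.integrableOn]
      ring
    rw [h3]
    exact (intervalIntegral.integral_hasDerivAt_right (hi.intervalIntegrable)
      (hcont.stronglyMeasurableAtFilter _ _) hcont.continuousAt).const_add _
  refine (h1.mul h2).congr_deriv ?_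
  have := exp_mul_gaussWeight w
  simp only [steinSol]
  linear_combination h w * this

/-- The derivative is (1 + w²) F(w) + w h(w). Monotonicity replaces h by the constant h(w) on one
tail, after which the Mills ratio bound shows that it is nonpositive. -/
lemma antitone_mul_steinSol {h : ℝ → ℝ} (hc : Continuous h) (hm : Monotone h)
    (hi : Integrable fun x => h x * gaussWeight x) (h0 : ∫ x, h x * gaussWeight x = 0) :
    Antitone fun w => w * steinSol h w := by
  have hd : ∀ w, HasDerivAt (fun w => w * steinSol h w)
      ((1 + w ^ 2) * steinSol h w + w * h w) w := fun w =>
    ((hasDerivAt_id w).mul (hasDerivAt_steinSol hc hi w)).congr_deriv (by simp; ring)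
  refine antitone_of_deriv_nonpos (fun w => (hd w).differentiableAt) fun w => ?_
  rw [(hd w).deriv]
  have hone := exp_mul_gaussWeight w
  have hE : 0 < Real.exp (w ^ 2 / 2) := Real.exp_pos _
  have hq : (0 : ℝ) < 1 + w ^ 2 := by positivity
  suffices hs : (1 + w ^ 2) * (∫ x in Iic w, h x * gaussWeight x)
      + w * h w * gaussWeight w ≤ 0 by
    have := mul_nonpos_of_nonneg_of_nonpos hE.le hs
    refine le_trans (le_of_eq ?_) this
    simp only [steinSol]
    linear_combination -(w * h w) * hone
  -- The Mills bound is multiplied by h(w), so its sign selects the tail. When h(w) ≥ 0, centring of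
  -- h moves the integral to the right tail.
  rcases le_total 0 (h w) with hw | hw
  · have hsplit : (∫ x in Iic w, h x * gaussWeight x) = -∫ x in Ioi w, h x * gaussWeight x := by
      have := intervalIntegral.integral_Iic_add_Ioi (b := w) hi.integrableOn hi.integrableOn
      rw [h0] at this; linarith
    have hle : h w * ∫ x in Ioi w, gaussWeight x ≤ ∫ x in Ioi w, h x * gaussWeight x := by
      rw [← integral_const_mul]
      refine setIntegral_mono_on (integrable_gaussWeight.const_mul _).integrableOn
        hi.integrableOn measurableSet_Ioi fun x hx => ?_
      exact mul_le_mul_of_nonneg_right (hm (le_of_lt hx)) (gaussWeight_pos x).le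
    have hmills := mul_le_mul_of_nonneg_left (mul_gaussWeight_le_setIntegral_Ioi w) hw
    have := mul_le_mul_of_nonneg_left hle hq.le
    rw [hsplit]
    nlinarith
  · have hle : ∫ x in Iic w, h x * gaussWeight x ≤ h w * ∫ x in Iic w, gaussWeight x := by
      rw [← integral_const_mul]
      refine setIntegral_mono_on hi.integrableOn
        (integrable_gaussWeight.const_mul _).integrableOn measurableSet_Iic fun x hx => ?_
      exact mul_le_mul_of_nonneg_right (hm hx) (gaussWeight_pos x).le
    have hmills := mul_le_mul_of_nonpos_left (neg_mul_gaussWeight_le_setIntegral_Iic w) hw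
    have := mul_le_mul_of_nonneg_left hle hq.le
    nlinarith

lemma integral_Iic_id_mul_gaussWeight (w : ℝ) :
    ∫ x in Iic w, x * gaussWeight x = -gaussWeight w := by
  have hd : ∀ x ∈ Iic w, HasDerivAt (fun x => -gaussWeight x) (x * gaussWeight x) x := fun x _ =>
    (hasDerivAt_gaussWeight x).neg.congr_deriv (by ring)
  have hlim : Tendsto (fun x => -gaussWeight x) atBot (𝓝 0) := by
    simpa using tendsto_gaussWeight_atBot.neg
  rw [integral_Iic_of_hasDerivAt_of_tendsto' hd integrable_id_mul_gaussWeight.integrableOn hlim]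
  simp

lemma integral_id_mul_gaussWeight : ∫ x, x * gaussWeight x = 0 := by
  have := integral_neg_eq_self (fun x => x * gaussWeight x) volume
  simp only [gaussWeight_neg, neg_mul, integral_neg] at this
  linarith

/-- The identity function has the constant −1 as its Stein solution, because the integral of x times
the weight up to w is minus the weight at w. -/
lemma steinSol_add_const_mul_id {h : ℝ → ℝ} (hi : Integrable fun x => h x * gaussWeight x)
    (a b w : ℝ) : steinSol (fun x => a * h x + b * x) w = a * steinSol h w - b := by
  have h1 : ∫ x in Iic w, (a * h x + b * x) * gaussWeight x
      = a * (∫ x in Iic w, h x * gaussWeight x) + b * -gaussWeight w := by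
    rw [← integral_Iic_id_mul_gaussWeight w, ← integral_const_mul, ← integral_const_mul,
      ← integral_add (hi.const_mul a).integrableOn
        (integrable_id_mul_gaussWeight.const_mul b).integrableOn]
    congr 1; ext x; ring
  have := exp_mul_gaussWeight w
  simp only [steinSol, h1]
  linear_combination -b * this

/-- Both h + id and −h + id are monotone and centred, with Stein solutions F − 1 and −F − 1. Hence w
F(w) − w and −w F(w) − w are decreasing, which are the two halves of the Lipschitz bound. -/
lemma abs_mul_steinSol_sub_le {h : ℝ → ℝ} (hL : LipschitzWith 1 h)
    (hi : Integrable fun x => h x * gaussWeight x) (h0 : ∫ x, h x * gaussWeight x = 0) (u v : ℝ) :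
    |u * steinSol h u - v * steinSol h v| ≤ |u - v| := by
  have key : ∀ a : ℝ, |a| = 1 → Antitone fun w => w * (a * steinSol h w - 1) := by
    intro a ha
    have hi' : Integrable fun x => (a * h x + 1 * x) * gaussWeight x := by
      refine ((hi.const_mul a).add (integrable_id_mul_gaussWeight.const_mul 1)).congr
        (ae_of_all _ fun x => ?_)
      simp only [Pi.add_apply]; ring
    have hm : Monotone fun x => a * h x + 1 * x := by
      intro x y hxy
      have h1 := hL.dist_le_mul x y
      rw [NNReal.coe_one, one_mul, Real.dist_eq, Real.dist_eq, abs_sub_comm x y,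
        abs_of_nonneg (sub_nonneg.2 hxy)] at h1
      have h2 : |a * (h x - h y)| ≤ y - x := by rwa [abs_mul, ha, one_mul]
      have := (abs_le.1 h2).2
      simp only
      linarith
    have h0' : ∫ x, (a * h x + 1 * x) * gaussWeight x = 0 := by
      have : (fun x => (a * h x + 1 * x) * gaussWeight x)
          = fun x => a * (h x * gaussWeight x) + x * gaussWeight x := by ext x; ring
      rw [this, integral_add (hi.const_mul a) integrable_id_mul_gaussWeight, integral_const_mul,
        h0, integral_id_mul_gaussWeight]
      simp
    have hc : Continuous fun x => a * h x + 1 * x := by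
      have := hL.continuous
      fun_prop
    simpa only [steinSol_add_const_mul_id hi] using antitone_mul_steinSol hc hm hi' h0'
  wlog huv : v ≤ u generalizing u v
  · rw [abs_sub_comm, abs_sub_comm u v]
    exact this v u (le_of_not_ge huv)
  have h1 := key 1 (by simp) huv
  have h2 := key (-1) (by simp) huv
  simp only at h1 h2
  rw [abs_of_nonneg (sub_nonneg.2 huv), abs_le]
  constructor <;> linarith

lemma integral_gaussianReal_eq (h : ℝ → ℝ) :
    ∫ x, h x ∂(gaussianReal 0 1) = (√(2 * Real.pi))⁻¹ * ∫ x, h x * gaussWeight x := by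
  rw [integral_gaussianReal_eq_integral_smul one_ne_zero, ← integral_const_mul]
  congr 1; ext x
  simp only [gaussianPDFReal, gaussWeight, smul_eq_mul, NNReal.coe_one, mul_one, sub_zero, neg_div]
  ring

lemma integrable_lipschitz_mul_gaussWeight {h : ℝ → ℝ} (hL : LipschitzWith 1 h) :
    Integrable fun x => h x * gaussWeight x := by
  refine ((integrable_gaussWeight.const_mul |h 0|).add
    integrable_id_mul_gaussWeight.norm).mono'
    (hL.continuous.mul continuous_gaussWeight).aestronglyMeasurable (ae_of_all _ fun x => ?_)
  have h1 := hL.dist_le_mul x 0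
  rw [NNReal.coe_one, one_mul, Real.dist_eq, Real.dist_eq, sub_zero] at h1
  have h2 : |h x| ≤ |h 0| + |x| := by
    have := abs_sub_abs_le_abs_sub (h x) (h 0); linarith
  have := mul_le_mul_of_nonneg_right h2 (gaussWeight_pos x).le
  simp only [norm_mul, Pi.add_apply, Real.norm_eq_abs, abs_of_pos (gaussWeight_pos x)]
  linarith

/-- For every `1`-Lipschitz test function, the Stein equation of the standard Gaussian law has a
solution which is bounded by `1` and whose derivative is `2`-Lipschitz. -/
theorem exists_stein_solution {h : ℝ → ℝ} (hL : LipschitzWith 1 h) :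
    ∃ F F' : ℝ → ℝ, (∀ w, HasDerivAt F (F' w) w) ∧
      (∀ w, F' w - w * F w = h w - ∫ x, h x ∂(gaussianReal 0 1)) ∧
      (∀ w, |F w| ≤ 1) ∧ ∀ u v, |F' u - F' v| ≤ 2 * |u - v| := by
  set m := ∫ x, h x ∂(gaussianReal 0 1) with hm
  set g : ℝ → ℝ := fun x => h x - m with hg
  have hgL : LipschitzWith 1 g := LipschitzWith.of_dist_le_mul fun x y => by
    simpa [hg, Real.dist_eq] using hL.dist_le_mul x y
  have hgi := integrable_lipschitz_mul_gaussWeight hgL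
  have hg0 : ∫ x, g x * gaussWeight x = 0 := by
    have hhi : Integrable h (gaussianReal 0 1) := by
      have hid : Integrable (fun x : ℝ => x) (gaussianReal 0 1) :=
        (memLp_id_gaussianReal (μ := 0) (v := 1) 1).integrable le_rfl
      refine ((integrable_const |h 0|).add hid.norm).mono'
        hL.continuous.aestronglyMeasurable (ae_of_all _ fun x => ?_)
      have h1 := hL.dist_le_mul x 0
      rw [NNReal.coe_one, one_mul, Real.dist_eq, Real.dist_eq, sub_zero] at h1
      have := abs_sub_abs_le_abs_sub (h x) (h 0)
      simp only [Pi.add_apply, Real.norm_eq_abs]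
      linarith
    have h1 : ∫ x, g x ∂(gaussianReal 0 1) = 0 := by
      rw [hg, integral_sub hhi (integrable_const _)]
      simp [hm]
    rw [integral_gaussianReal_eq] at h1
    have : (√(2 * Real.pi))⁻¹ ≠ 0 := by positivity
    exact (mul_eq_zero.1 h1).resolve_left this
  have hd := hasDerivAt_steinSol hgL.continuous hgi
  have hlip := abs_mul_steinSol_sub_le hgL hgi hg0
  refine ⟨steinSol g, fun w => g w + w * steinSol g w, hd, fun w => by simp [hg], ?_, ?_⟩
  · have hcont : Continuous (steinSol g) := continuous_iff_continuousAt.2 fun w => (hd w).continuousAt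
    -- Comparing w F(w) with its value 0 at the origin gives |w| |F(w)| ≤ |w|. The point w = 0,
    -- where |w| cannot be cancelled, is recovered by continuity.
    have hne : ∀ w ∈ ({0}ᶜ : Set ℝ), |steinSol g w| ≤ 1 := by
      intro w hw
      have := hlip w 0
      simp only [zero_mul, sub_zero, abs_mul] at this
      have hw' : 0 < |w| := abs_pos.2 hw
      nlinarith
    have hcl : IsClosed {w | |steinSol g w| ≤ 1} :=
      isClosed_le hcont.abs continuous_const
    have hdense : Dense ({0}ᶜ : Set ℝ) := dense_compl_singleton 0
    intro w
    have := hcl.closure_subset_iff.2 hne (hdense w)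
    exact this
  · intro u v
    have h1 := hlip u v
    have h2 := hgL.dist_le_mul u v
    rw [NNReal.coe_one, one_mul, Real.dist_eq, Real.dist_eq] at h2
    have h3 : g u + u * steinSol g u - (g v + v * steinSol g v)
      = (g u - g v) + (u * steinSol g u - v * steinSol g v) := by ring
    rw [h3]
    refine (abs_add_le _ _).trans ?_
    linarith

/-! ### The central limit theorem by leaving one summand out. -/

lemma abs_taylor_one_le {F F' : ℝ → ℝ} (hd : ∀ w, HasDerivAt F (F' w) w)
    (hL : ∀ u v, |F' u - F' v| ≤ 2 * |u - v|) (u y : ℝ) :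
    |F (u + y) - F u - y * F' u| ≤ y ^ 2 := by
  -- The sign of y is split off so that the increment is followed along [0, |y|], where its
  -- derivative is at most 2t and it is compared with t².
  obtain ⟨s, hs, hy⟩ : ∃ s : ℝ, |s| = 1 ∧ s * |y| = y := by
    rcases le_total 0 y with h | h
    · exact ⟨1, by simp, by rw [abs_of_nonneg h, one_mul]⟩
    · exact ⟨-1, by simp, by rw [abs_of_nonpos h]; ring⟩
  have hG : ∀ t, HasDerivAt (fun t => F (u + s * t) - F u - s * t * F' u)
      (s * (F' (u + s * t) - F' u)) t := by
    intro t
    have h1 : HasDerivAt (fun t => u + s * t) s t :=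
      (((hasDerivAt_id t).const_mul s).const_add u).congr_deriv (by simp)
    have h2 : HasDerivAt (fun t => s * t * F' u) (s * F' u) t :=
      (((hasDerivAt_id t).const_mul s).mul_const (F' u)).congr_deriv (by simp)
    have h3 := ((hd (u + s * t)).comp t h1).sub_const (F u) |>.sub h2
    exact h3.congr_deriv (by ring)
  have hB : ∀ t : ℝ, HasDerivAt (fun t => t ^ 2) (2 * t) t := fun t => by
    simpa using hasDerivAt_pow 2 t
  have := image_norm_le_of_norm_deriv_right_le_deriv_boundary (a := 0) (b := |y|)
    (f := fun t => F (u + s * t) - F u - s * t * F' u) (B := fun t => t ^ 2)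
    (f' := fun t => s * (F' (u + s * t) - F' u)) (B' := fun t => 2 * t)
    (fun t _ => (hG t).continuousAt.continuousWithinAt) (fun t _ => (hG t).hasDerivWithinAt)
    (by simp) hB (fun t ht => by
      have h1 := hL (u + s * t) u
      rw [add_sub_cancel_left, abs_mul, hs, one_mul, abs_of_nonneg ht.1] at h1
      rwa [norm_mul, Real.norm_eq_abs, Real.norm_eq_abs, hs, one_mul])
    (right_mem_Icc.2 (abs_nonneg y))
  simpa [hy] using this

lemma integrable_comp_of_abs_sub_le {Ω : Type*} [MeasurableSpace Ω] {P : Measure Ω}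
    [IsFiniteMeasure P] {G : ℝ → ℝ} {c : ℝ} (hG : ∀ u v, |G u - G v| ≤ c * |u - v|) {U : Ω → ℝ}
    (hU : Integrable U P) : Integrable (fun ω => G (U ω)) P := by
  have hc : Continuous G := by
    refine (LipschitzWith.of_dist_le_mul (K := Real.toNNReal c) fun u v => ?_).continuous
    refine (hG u v).trans ?_
    exact mul_le_mul_of_nonneg_right (Real.le_coe_toNNReal c) (abs_nonneg _)
  refine ((integrable_const |G 0|).add (hU.norm.const_mul c)).mono'
    (hc.comp_aestronglyMeasurable hU.aestronglyMeasurable) (ae_of_all _ fun ω => ?_)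
  have h1 := hG (U ω) 0
  rw [sub_zero] at h1
  have := abs_sub_abs_le_abs_sub (G (U ω)) (G 0)
  simp only [Pi.add_apply, Real.norm_eq_abs]
  linarith

lemma memLp_three_integrable {Ω : Type*} [MeasurableSpace Ω] {P : Measure Ω}
    [IsFiniteMeasure P] {Y : Ω → ℝ} (hY : MemLp Y 3 P) :
    Integrable Y P ∧ Integrable (fun ω => Y ω ^ 2) P ∧ Integrable (fun ω => |Y ω| ^ 3) P := by
  refine ⟨hY.integrable (by norm_num), (hY.mono_exponent (by norm_num)).integrable_sq, ?_⟩
  simpa using hY.integrable_norm_pow (p := 3) (by norm_num)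

/-- One summand in the leave-one-out form of Stein's method. -/
lemma abs_integral_mul_sub_le {Ω : Type*} [MeasurableSpace Ω] {P : Measure Ω}
    [IsProbabilityMeasure P] {F F' : ℝ → ℝ} (hd : ∀ w, HasDerivAt F (F' w) w)
    (hb : ∀ w, |F w| ≤ 1) (hL : ∀ u v, |F' u - F' v| ≤ 2 * |u - v|)
    {U Y : Ω → ℝ} (hUY : IndepFun U Y P) (hU : Integrable U P) (hY : MemLp Y 3 P)
    (hY0 : ∫ ω, Y ω ∂P = 0) :
    |(∫ ω, Y ω * F (U ω + Y ω) ∂P) - (∫ ω, Y ω ^ 2 ∂P) * ∫ ω, F' (U ω + Y ω) ∂P|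
      ≤ (∫ ω, |Y ω| ^ 3 ∂P) + 2 * ((∫ ω, Y ω ^ 2 ∂P) * ∫ ω, |Y ω| ∂P) := by
  obtain ⟨hY1, hY2, hY3⟩ := memLp_three_integrable hY
  have hFc : Continuous F := continuous_iff_continuousAt.2 fun w => (hd w).continuousAt
  have hF'c : Continuous F' := by
    refine (LipschitzWith.of_dist_le_mul (K := 2) fun u v => ?_).continuous
    simpa [Real.dist_eq] using hL u v
  have hUF' := integrable_comp_of_abs_sub_le hL hU
  have hUYF' : Integrable (fun ω => F' (U ω + Y ω)) P :=
    integrable_comp_of_abs_sub_le hL (hU.add hY1)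
  have hYFU : Integrable (fun ω => Y ω * F (U ω)) P :=
    hY1.mul_bdd (c := 1) (hFc.comp_aestronglyMeasurable hU.aestronglyMeasurable)
      (ae_of_all _ fun ω => hb _)
  have hYFUY : Integrable (fun ω => Y ω * F (U ω + Y ω)) P :=
    hY1.mul_bdd (c := 1)
      (hFc.comp_aestronglyMeasurable (hU.add hY1).aestronglyMeasurable)
      (ae_of_all _ fun ω => hb _)
  have hindF : IndepFun (fun ω => Y ω) (fun ω => F (U ω)) P :=
    (hUY.comp hFc.measurable measurable_id).symm
  have hindF' : IndepFun (fun ω => Y ω ^ 2) (fun ω => F' (U ω)) P :=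
    (hUY.comp hF'c.measurable (measurable_id.pow_const 2)).symm
  have hYF' : Integrable (fun ω => Y ω ^ 2 * F' (U ω)) P := hindF'.integrable_mul hY2 hUF'
  -- Independence enters here: the zeroth-order term of the expansion at U vanishes as Y is centred,
  -- and the first-order term factorises.
  have e1 : ∫ ω, Y ω * F (U ω) ∂P = 0 := by
    rw [hindF.integral_fun_mul_eq_mul_integral hY1.aestronglyMeasurable
      (hFc.comp_aestronglyMeasurable hU.aestronglyMeasurable), hY0, zero_mul]
  have e2 : ∫ ω, Y ω ^ 2 * F' (U ω) ∂P = (∫ ω, Y ω ^ 2 ∂P) * ∫ ω, F' (U ω) ∂P :=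
    hindF'.integral_fun_mul_eq_mul_integral hY2.aestronglyMeasurable hUF'.aestronglyMeasurable
  have b1 : |∫ ω, (Y ω * F (U ω + Y ω) - Y ω * F (U ω) - Y ω ^ 2 * F' (U ω)) ∂P|
      ≤ ∫ ω, |Y ω| ^ 3 ∂P := by
    refine norm_integral_le_of_norm_le (f := fun ω =>
      Y ω * F (U ω + Y ω) - Y ω * F (U ω) - Y ω ^ 2 * F' (U ω)) hY3 (ae_of_all _ fun ω => ?_)
    have h1 := abs_taylor_one_le hd hL (U ω) (Y ω)
    have h2 : Y ω * F (U ω + Y ω) - Y ω * F (U ω) - Y ω ^ 2 * F' (U ω)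
      = Y ω * (F (U ω + Y ω) - F (U ω) - Y ω * F' (U ω)) := by ring
    rw [h2, Real.norm_eq_abs, abs_mul]
    refine (mul_le_mul_of_nonneg_left h1 (abs_nonneg _)).trans (le_of_eq ?_)
    rw [← sq_abs]; ring
  have b2 : |∫ ω, (F' (U ω) - F' (U ω + Y ω)) ∂P| ≤ 2 * ∫ ω, |Y ω| ∂P := by
    rw [← integral_const_mul]
    refine norm_integral_le_of_norm_le (f := fun ω => F' (U ω) - F' (U ω + Y ω))
      (hY1.norm.const_mul 2) (ae_of_all _ fun ω => ?_)
    simpa using hL (U ω) (U ω + Y ω)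
  have hs : 0 ≤ ∫ ω, Y ω ^ 2 ∂P := integral_nonneg fun ω => sq_nonneg _
  have i1 : ∫ ω, (Y ω * F (U ω + Y ω) - Y ω * F (U ω) - Y ω ^ 2 * F' (U ω)) ∂P
      = (∫ ω, Y ω * F (U ω + Y ω) ∂P) - (∫ ω, Y ω ^ 2 ∂P) * ∫ ω, F' (U ω) ∂P := by
    have hsub : Integrable (fun ω => Y ω * F (U ω + Y ω) - Y ω * F (U ω)) P := hYFUY.sub hYFU
    rw [integral_sub hsub hYF', integral_sub hYFUY hYFU, e1, e2, sub_zero]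
  have i2 := integral_sub hUF' hUYF'
  have key : (∫ ω, Y ω * F (U ω + Y ω) ∂P) - (∫ ω, Y ω ^ 2 ∂P) * ∫ ω, F' (U ω + Y ω) ∂P
      = (∫ ω, (Y ω * F (U ω + Y ω) - Y ω * F (U ω) - Y ω ^ 2 * F' (U ω)) ∂P)
        + (∫ ω, Y ω ^ 2 ∂P) * ∫ ω, (F' (U ω) - F' (U ω + Y ω)) ∂P := by
    rw [i1, i2]; ring
  rw [key]
  refine (abs_add_le _ _).trans (add_le_add b1 ?_)
  rw [abs_mul, abs_of_nonneg hs]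
  refine (mul_le_mul_of_nonneg_left b2 hs).trans (le_of_eq (by ring))

/-- A Wasserstein bound in the central limit theorem for independent summands. -/
theorem abs_integral_comp_sum_sub_le {Ω : Type*} [MeasurableSpace Ω] {P : Measure Ω}
    [IsProbabilityMeasure P] {ι : Type*} [Fintype ι] {Y : ι → Ω → ℝ} (hind : iIndepFun Y P)
    (hY : ∀ i, MemLp (Y i) 3 P) (hY0 : ∀ i, ∫ ω, Y i ω ∂P = 0)
    (hvar : ∑ i, ∫ ω, Y i ω ^ 2 ∂P = 1) {h : ℝ → ℝ} (hL : LipschitzWith 1 h) :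
    |(∫ ω, h (∑ i, Y i ω) ∂P) - ∫ x, h x ∂(gaussianReal 0 1)|
      ≤ ∑ i, ((∫ ω, |Y i ω| ^ 3 ∂P) + 2 * ((∫ ω, Y i ω ^ 2 ∂P) * ∫ ω, |Y i ω| ∂P)) := by
  classical
  obtain ⟨F, F', hd, heq, hb, hF'⟩ := exists_stein_solution hL
  have hYi : ∀ i, Integrable (Y i) P := fun i => (memLp_three_integrable (hY i)).1
  have hW : Integrable (fun ω => ∑ i, Y i ω) P := integrable_finsetSum _ fun i _ => hYi i
  have hFc : Continuous F := continuous_iff_continuousAt.2 fun w => (hd w).continuousAt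
  have hF'W : Integrable (fun ω => F' (∑ i, Y i ω)) P := integrable_comp_of_abs_sub_le hF' hW
  have hYF : ∀ i, Integrable (fun ω => Y i ω * F (∑ j, Y j ω)) P := fun i =>
    (hYi i).mul_bdd (c := 1) (hFc.comp_aestronglyMeasurable hW.aestronglyMeasurable)
      (ae_of_all _ fun ω => hb _)
  have hhW : Integrable (fun ω => h (∑ i, Y i ω)) P :=
    integrable_comp_of_abs_sub_le (c := 1) (fun u v => by
      simpa [Real.dist_eq] using hL.dist_le_mul u v) hW
  have e1 : (∫ ω, h (∑ i, Y i ω) ∂P) - ∫ x, h x ∂(gaussianReal 0 1)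
      = (∫ ω, F' (∑ i, Y i ω) ∂P) - ∑ i, ∫ ω, Y i ω * F (∑ j, Y j ω) ∂P := by
    rw [← integral_finsetSum _ fun i _ => hYF i, ← integral_sub hF'W
      (integrable_finsetSum _ fun i _ => hYF i)]
    have : (∫ ω, h (∑ i, Y i ω) ∂P) - ∫ x, h x ∂(gaussianReal 0 1)
        = ∫ ω, (h (∑ i, Y i ω) - ∫ x, h x ∂(gaussianReal 0 1)) ∂P := by
      rw [integral_sub hhW (integrable_const _)]; simp
    rw [this]
    congr 1; ext ω
    rw [← heq, Finset.sum_mul]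
  -- As the variances sum to 1, the mean of F' is distributed over the summands with these weights.
  have e2 : (∫ ω, F' (∑ i, Y i ω) ∂P) - ∑ i, ∫ ω, Y i ω * F (∑ j, Y j ω) ∂P
      = -∑ i, ((∫ ω, Y i ω * F (∑ j, Y j ω) ∂P)
        - (∫ ω, Y i ω ^ 2 ∂P) * ∫ ω, F' (∑ j, Y j ω) ∂P) := by
    rw [Finset.sum_sub_distrib, ← Finset.sum_mul, hvar]; ring
  rw [e1, e2, abs_neg]
  refine (Finset.abs_sum_le_sum_abs _ _).trans (Finset.sum_le_sum fun i _ => ?_)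
  have hUY : IndepFun (∑ j ∈ Finset.univ.erase i, Y j) (Y i) P :=
    hind.indepFun_finsetSum_of_notMem₀ (fun j => (hYi j).aestronglyMeasurable.aemeasurable)
      (Finset.notMem_erase i _)
  have hU : Integrable (∑ j ∈ Finset.univ.erase i, Y j) P := integrable_finsetSum' _ fun j _ => hYi j
  have hsum : ∀ ω, (∑ j ∈ Finset.univ.erase i, Y j) ω + Y i ω = ∑ j, Y j ω := fun ω => by
    rw [Finset.sum_apply, Finset.sum_erase_add _ _ (Finset.mem_univ i)]
  have := abs_integral_mul_sub_le hd hb hF' hUY hU (hY i) (hY0 i)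
  simpa only [hsum] using this

/-- The Wasserstein bound in the central limit theorem for i.i.d. summands with variance `v`. -/
theorem abs_integral_comp_normalized_sum_sub_le {Ω : Type*} [MeasurableSpace Ω] {P : Measure Ω}
    [IsProbabilityMeasure P] {n : ℕ} [NeZero n] {ξ : Fin n → Ω → ℝ} (hind : iIndepFun ξ P)
    (hξ : ∀ i, MemLp (ξ i) 3 P) (hξ0 : ∀ i, ∫ ω, ξ i ω ∂P = 0) {v ρ : ℝ} (hv : 0 < v)
    (hξv : ∀ i, ∫ ω, ξ i ω ^ 2 ∂P = v) (hξρ : ∀ i, ∫ ω, |ξ i ω| ^ 3 ∂P = ρ)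
    {h : ℝ → ℝ} (hL : LipschitzWith 1 h) :
    |(∫ ω, h ((∑ i, ξ i ω) / √(n * v)) ∂P) - ∫ x, h x ∂(gaussianReal 0 1)|
      ≤ 1 / √n * (2 + 1 / v ^ (3 / 2 : ℝ) * ρ) := by
  have hn : (0 : ℝ) < n := Nat.cast_pos.2 (Nat.pos_of_ne_zero (NeZero.ne n))
  have hnv : 0 < n * v := mul_pos hn hv
  set c : ℝ := (√(n * v))⁻¹ with hc
  have hc0 : 0 < c := inv_pos.2 (Real.sqrt_pos.2 hnv)
  have hc2 : c ^ 2 * (n * v) = 1 := by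
    rw [hc, inv_pow, Real.sq_sqrt hnv.le, inv_mul_cancel₀ hnv.ne']
  have hindY : iIndepFun (fun i ω => c * ξ i ω) P :=
    hind.comp (fun _ x => c * x) fun _ => measurable_const_mul c
  have hsq : ∀ i, ∫ ω, (c * ξ i ω) ^ 2 ∂P = c ^ 2 * v := fun i => by
    simp_rw [mul_pow, integral_const_mul, hξv]
  have hcube : ∀ i, ∫ ω, |c * ξ i ω| ^ 3 ∂P = c ^ 3 * ρ := fun i => by
    simp_rw [abs_mul, mul_pow, integral_const_mul, hξρ, abs_of_pos hc0]
  -- The variance of |ξ i| is nonnegative.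
  have habs : ∀ i, ∫ ω, |ξ i ω| ∂P ≤ √v := fun i => by
    refine Real.le_sqrt_of_sq_le ?_
    obtain ⟨h1, h2, -⟩ := memLp_three_integrable (hξ i)
    have hvn := variance_nonneg (fun ω => |ξ i ω|) P
    have hm : MemLp (fun ω => |ξ i ω|) 2 P := ((hξ i).mono_exponent (by norm_num)).norm
    rw [variance_eq_sub hm] at hvn
    simp only [Pi.pow_apply, sq_abs, hξv] at hvn
    linarith
  have key := abs_integral_comp_sum_sub_le hindY (fun i => (hξ i).const_mul c)
    (fun i => by simp [integral_const_mul, hξ0]) (by simp only [hsq]; simp; linarith) hL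
  simp only [hsq, hcube, ← Finset.mul_sum] at key
  have hdiv : ∀ ω, (∑ i, ξ i ω) / √(n * v) = c * ∑ i, ξ i ω := fun ω => by
    rw [hc, div_eq_inv_mul]
  simp only [hdiv]
  refine key.trans ?_
  have hsn : 0 < √(n : ℝ) := Real.sqrt_pos.2 hn
  have hsv : 0 < √v := Real.sqrt_pos.2 hv
  have hcc : c * √v = 1 / √n := by
    rw [hc, Real.sqrt_mul hn.le]; field_simp
  have hpow : v ^ (3 / 2 : ℝ) = √v ^ 3 := by
    rw [Real.sqrt_eq_rpow, ← Real.rpow_natCast, ← Real.rpow_mul hv.le]; norm_num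
  have hterm : ∀ i, c ^ 3 * ρ + 2 * (c ^ 2 * v * ∫ ω, |c * ξ i ω| ∂P)
      ≤ c ^ 3 * ρ + 2 * (c ^ 2 * v * (1 / √n)) := fun i => by
    have : ∫ ω, |c * ξ i ω| ∂P ≤ 1 / √n := by
      simp_rw [abs_mul, integral_const_mul, abs_of_pos hc0]
      rw [← hcc]
      exact mul_le_mul_of_nonneg_left (habs i) hc0.le
    gcongr
  refine (Finset.sum_le_sum fun i _ => hterm i).trans (le_of_eq ?_)
  rw [Finset.sum_const, Finset.card_univ, Fintype.card_fin, nsmul_eq_mul, hpow]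
  have hcv : c = 1 / √n / √v := by rw [← hcc]; field_simp
  have h3 : n * c ^ 3 = 1 / √n * (1 / √v ^ 3) := by
    have : (n : ℝ) = √n ^ 2 := (Real.sq_sqrt hn.le).symm
    rw [hcv]
    nth_rewrite 1 [this]
    field_simp
  linear_combination ρ * h3 + 2 / √n * hc2

/-! ### Second-order Taylor estimate and Cauchy–Schwarz. -/

lemma abs_taylor_two_le {g g' g'' : ℝ → ℝ} {a b K : ℝ}
    (h1 : ∀ c ∈ uIcc a b, HasDerivAt g (g' c) c) (h2 : ∀ c ∈ uIcc a b, HasDerivAt g' (g'' c) c)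
    (hK : ∀ c ∈ uIcc a b, |g'' c| ≤ K) :
    |g b - g a - (b - a) * g' a| ≤ (b - a) ^ 2 / 2 * K := by
  have hmem : ∀ t ∈ Icc (0 : ℝ) 1, a + t * (b - a) ∈ uIcc a b := fun t ht => by
    have := (convex_uIcc a b).add_smul_sub_mem left_mem_uIcc right_mem_uIcc ht
    simpa using this
  have hG : ∀ t ∈ Icc (0 : ℝ) 1,
      HasDerivAt (fun t => g (a + t * (b - a)) - g a - t * (b - a) * g' a)
        ((b - a) * (g' (a + t * (b - a)) - g' a)) t := by
    intro t ht
    have e1 : HasDerivAt (fun t => a + t * (b - a)) (b - a) t :=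
      (((hasDerivAt_id t).mul_const (b - a)).const_add a).congr_deriv (by simp)
    have e2 : HasDerivAt (fun t => t * (b - a) * g' a) ((b - a) * g' a) t :=
      (((hasDerivAt_id t).mul_const (b - a)).mul_const (g' a)).congr_deriv (by simp)
    exact ((((h1 _ (hmem t ht)).comp t e1).sub_const (g a)).sub e2).congr_deriv (by ring)
  have hB : ∀ t : ℝ, HasDerivAt (fun t => (b - a) ^ 2 / 2 * K * t ^ 2) ((b - a) ^ 2 * K * t) t :=
    fun t => ((hasDerivAt_pow 2 t).const_mul ((b - a) ^ 2 / 2 * K)).congr_deriv (by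
      simp only [Nat.cast_ofNat]; ring)
  have := image_norm_le_of_norm_deriv_right_le_deriv_boundary (a := 0) (b := 1)
    (fun t ht => (hG t ht).continuousAt.continuousWithinAt)
    (fun t ht => (hG t (Ico_subset_Icc_self ht)).hasDerivWithinAt) (by simp) hB
    (fun t ht => by
      -- The mean value inequality for g' bounds the derivative along the segment linearly in t; the
      -- comparison function integrates this to the factor 1/2. No intermediate point is chosen, and
      -- b may lie on either side of a.
      have hc := Convex.norm_image_sub_le_of_norm_hasDerivWithin_le (s := uIcc a b) (C := K)
        (fun c hc => (h2 c hc).hasDerivWithinAt) hK (convex_uIcc a b) left_mem_uIcc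
        (hmem t (Ico_subset_Icc_self ht))
      rw [norm_mul]
      refine (mul_le_mul_of_nonneg_left hc (norm_nonneg _)).trans (le_of_eq ?_)
      rw [add_sub_cancel_left, norm_mul, Real.norm_of_nonneg ht.1, Real.norm_eq_abs,
        ← sq_abs (b - a)]
      ring)
    (right_mem_Icc.2 zero_le_one)
  simpa using this

lemma integral_abs_mul_abs_le {Ω : Type*} [MeasurableSpace Ω] {P : Measure Ω} {u v : Ω → ℝ}
    (hu : MemLp u 2 P) (hv : MemLp v 2 P) :
    ∫ ω, |u ω| * |v ω| ∂P ≤ √(∫ ω, u ω ^ 2 ∂P) * √(∫ ω, v ω ^ 2 ∂P) := by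
  have := integral_mul_norm_le_Lp_mul_Lq (μ := P) (f := u) (g := v) Real.HolderConjugate.two_two
    (by simpa using hu) (by simpa using hv)
  simpa [Real.sqrt_eq_rpow] using this

/-! ### Score identities for a smooth density family. -/

section Model

variable {ν : Measure ℝ} {Θ : Set ℝ} {f : ℝ → ℝ → ℝ} {θ₀ : ℝ}

lemma IsDensityFamily.measurable_ofReal (hf : IsDensityFamily ν Θ f) (hθ₀ : θ₀ ∈ Θ) :
    Measurable fun x => ENNReal.ofReal (f θ₀ x) := (hf.measurable θ₀ hθ₀).ennreal_ofReal

/-- Formulas for derivatives of log f are available only where the density is positive; the law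
gives no mass to the rest. -/
lemma ae_law_of_forall (hf : IsDensityFamily ν Θ f) (hθ₀ : θ₀ ∈ Θ) {p : ℝ → Prop}
    (h : ∀ x, 0 < f θ₀ x → p x) : ∀ᵐ x ∂(law ν f θ₀), p x := by
  rw [law, ae_withDensity_iff (hf.measurable_ofReal hθ₀)]
  exact ae_of_all _ fun x hx => h x (by simpa using hx)

lemma integral_law (hf : IsDensityFamily ν Θ f) (hθ₀ : θ₀ ∈ Θ) (g : ℝ → ℝ) :
    ∫ x, g x ∂(law ν f θ₀) = ∫ x, f θ₀ x * g x ∂ν := by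
  rw [law, integral_withDensity_eq_integral_toReal_smul (hf.measurable_ofReal hθ₀)
    (ae_of_all _ fun x => ENNReal.ofReal_lt_top)]
  simp [ENNReal.toReal_ofReal (hf.nonneg θ₀ hθ₀ _)]

lemma integral_density_eq_one (hf : IsDensityFamily ν Θ f) {θ : ℝ} (hθ : θ ∈ Θ) :
    ∫ x, f θ x ∂ν = 1 := by
  rw [integral_eq_lintegral_of_nonneg_ae (ae_of_all _ (hf.nonneg θ hθ))
    (hf.measurable θ hθ).aestronglyMeasurable, hf.lintegral_eq_one θ hθ, ENNReal.toReal_one]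

lemma integral_iteratedDeriv_one_eq_zero (hΘ : IsOpen Θ) (hf : IsDensityFamily ν Θ f)
    (hR2 : R2 ν Θ f) {θ : ℝ} (hθ : θ ∈ Θ) :
    ∫ x, iteratedDeriv 1 (fun t => f t x) θ ∂ν = 0 := by
  have h := hR2.hasDerivAt 0 (by norm_num) θ hθ
  have hc : (fun s => ∫ x, iteratedDeriv 0 (fun t => f t x) s ∂ν) =ᶠ[𝓝 θ] fun _ => 1 := by
    filter_upwards [hΘ.mem_nhds hθ] with s hs
    simpa using integral_density_eq_one hf hs
  exact h.unique ((hasDerivAt_const θ 1).congr_of_eventuallyEq hc)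

lemma integral_iteratedDeriv_two_eq_zero (hΘ : IsOpen Θ) (hf : IsDensityFamily ν Θ f)
    (hR2 : R2 ν Θ f) {θ : ℝ} (hθ : θ ∈ Θ) :
    ∫ x, iteratedDeriv 2 (fun t => f t x) θ ∂ν = 0 := by
  have h := hR2.hasDerivAt 1 (by norm_num) θ hθ
  have hc : (fun s => ∫ x, iteratedDeriv 1 (fun t => f t x) s ∂ν) =ᶠ[𝓝 θ] fun _ => 0 := by
    filter_upwards [hΘ.mem_nhds hθ] with s hs
    exact integral_iteratedDeriv_one_eq_zero hΘ hf hR2 hs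
  exact h.unique ((hasDerivAt_const θ 0).congr_of_eventuallyEq hc)

/-- With a common support, the density at such an x vanishes for every parameter in the open set Θ.
This lets integrals against the law be identified with integrals against `ν` over the whole line. -/
lemma iteratedDeriv_eq_zero_of_notMem_support (hΘ : IsOpen Θ) (hf : IsDensityFamily ν Θ f)
    (hθ₀ : θ₀ ∈ Θ) {x : ℝ} (hx : ¬ 0 < f θ₀ x) (k : ℕ) :
    iteratedDeriv k (fun t => f t x) θ₀ = 0 := by
  have h : (fun t => f t x) =ᶠ[𝓝 θ₀] fun _ => 0 := by
    filter_upwards [hΘ.mem_nhds hθ₀] with t ht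
    refine le_antisymm ?_ (hf.nonneg t ht x)
    by_contra hcon
    exact hx (hf.common_support t ht θ₀ hθ₀ x (not_le.1 hcon))
  rw [h.iteratedDeriv_eq]
  simp

lemma contDiffOn_log (hf : IsDensityFamily ν Θ f) (hR2 : R2 ν Θ f) (hθ₀ : θ₀ ∈ Θ) {x : ℝ}
    (hx : 0 < f θ₀ x) : ContDiffOn ℝ 3 (fun t => Real.log (f t x)) Θ :=
  (hR2.contDiffOn x).log fun t ht => (hf.common_support θ₀ hθ₀ t ht x hx).ne'

lemma deriv_log_density (hΘ : IsOpen Θ) (hf : IsDensityFamily ν Θ f) (hR2 : R2 ν Θ f)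
    (hθ₀ : θ₀ ∈ Θ) {x : ℝ} (hx : 0 < f θ₀ x) {θ : ℝ} (hθ : θ ∈ Θ) :
    deriv (fun t => Real.log (f t x)) θ = deriv (fun t => f t x) θ / f θ x := by
  have hd : DifferentiableAt ℝ (fun t => f t x) θ :=
    ((hR2.contDiffOn x).contDiffAt (hΘ.mem_nhds hθ)).differentiableAt (by norm_num)
  exact deriv.log hd (hf.common_support θ₀ hθ₀ θ hθ x hx).ne'

lemma iteratedDeriv_two_log_density (hΘ : IsOpen Θ) (hf : IsDensityFamily ν Θ f)
    (hR2 : R2 ν Θ f) (hθ₀ : θ₀ ∈ Θ) {x : ℝ} (hx : 0 < f θ₀ x) :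
    iteratedDeriv 2 (fun t => Real.log (f t x)) θ₀
      = iteratedDeriv 2 (fun t => f t x) θ₀ / f θ₀ x
        - (deriv (fun t => Real.log (f t x)) θ₀) ^ 2 := by
  have hne := hx.ne'
  have hd : DifferentiableAt ℝ (fun t => f t x) θ₀ :=
    ((hR2.contDiffOn x).contDiffAt (hΘ.mem_nhds hθ₀)).differentiableAt (by norm_num)
  have hd2 : DifferentiableAt ℝ (deriv fun t => f t x) θ₀ :=
    (((hR2.contDiffOn x).deriv_of_isOpen (m := 2) hΘ (by norm_num)).contDiffAt
      (hΘ.mem_nhds hθ₀)).differentiableAt (by norm_num)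
  have he : deriv (fun t => Real.log (f t x)) =ᶠ[𝓝 θ₀]
      fun θ => deriv (fun t => f t x) θ / f θ x := by
    filter_upwards [hΘ.mem_nhds hθ₀] with θ hθ
    exact deriv_log_density hΘ hf hR2 hθ₀ hx hθ
  rw [iteratedDeriv_succ, iteratedDeriv_one, he.deriv_eq, iteratedDeriv_succ, iteratedDeriv_one,
    deriv_log_density hΘ hf hR2 hθ₀ hx hθ₀, deriv_fun_div hd2 hd hne]
  field_simp

/-- On the support the score is the quotient f'/f, whose numerator is measurable up to null sets by
the integrability in (R2). -/
lemma aemeasurable_score (hΘ : IsOpen Θ) (hf : IsDensityFamily ν Θ f) (hR2 : R2 ν Θ f)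
    (hθ₀ : θ₀ ∈ Θ) :
    AEMeasurable (fun x => deriv (fun t => Real.log (f t x)) θ₀) (law ν f θ₀) := by
  have h1 := ((hR2.integrable 1 (by norm_num) θ₀ hθ₀).aestronglyMeasurable.aemeasurable).mono_ac
    (withDensity_absolutelyContinuous ν fun x => ENNReal.ofReal (f θ₀ x))
  refine (h1.div (hf.measurable θ₀ hθ₀).aemeasurable).congr ?_
  refine ae_law_of_forall hf hθ₀ fun x hx => ?_
  simp [deriv_log_density hΘ hf hR2 hθ₀ hx hθ₀]

lemma aemeasurable_iteratedDeriv_two_log (hΘ : IsOpen Θ) (hf : IsDensityFamily ν Θ f)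
    (hR2 : R2 ν Θ f) (hθ₀ : θ₀ ∈ Θ) :
    AEMeasurable (fun x => iteratedDeriv 2 (fun t => Real.log (f t x)) θ₀) (law ν f θ₀) := by
  have h1 := ((hR2.integrable 2 (by norm_num) θ₀ hθ₀).aestronglyMeasurable.aemeasurable).mono_ac
    (withDensity_absolutelyContinuous ν fun x => ENNReal.ofReal (f θ₀ x))
  refine ((h1.div (hf.measurable θ₀ hθ₀).aemeasurable).sub
    ((aemeasurable_score hΘ hf hR2 hθ₀).pow_const 2)).congr ?_
  refine ae_law_of_forall hf hθ₀ fun x hx => ?_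
  simp [iteratedDeriv_two_log_density hΘ hf hR2 hθ₀ hx]

lemma integral_score (hΘ : IsOpen Θ) (hf : IsDensityFamily ν Θ f) (hR2 : R2 ν Θ f)
    (hθ₀ : θ₀ ∈ Θ) : ∫ x, deriv (fun t => Real.log (f t x)) θ₀ ∂(law ν f θ₀) = 0 := by
  rw [integral_law hf hθ₀, ← integral_iteratedDeriv_one_eq_zero hΘ hf hR2 hθ₀]
  congr 1; ext x
  by_cases hx : 0 < f θ₀ x
  · rw [deriv_log_density hΘ hf hR2 hθ₀ hx hθ₀, iteratedDeriv_one, mul_div_cancel₀ _ hx.ne']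
  · rw [iteratedDeriv_eq_zero_of_notMem_support hΘ hf hθ₀ hx,
      le_antisymm (not_lt.1 hx) (hf.nonneg θ₀ hθ₀ x), zero_mul]

/-- The second Bartlett identity. -/
lemma integral_iteratedDeriv_two_log (hΘ : IsOpen Θ) (hf : IsDensityFamily ν Θ f)
    (hR2 : R2 ν Θ f) (hθ₀ : θ₀ ∈ Θ)
    (hs : Integrable (fun x => (deriv (fun t => Real.log (f t x)) θ₀) ^ 2) (law ν f θ₀))
    (hq : Integrable (fun x => iteratedDeriv 2 (fun t => Real.log (f t x)) θ₀) (law ν f θ₀)) :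
    ∫ x, iteratedDeriv 2 (fun t => Real.log (f t x)) θ₀ ∂(law ν f θ₀)
      = -fisherInfo ν f θ₀ := by
  -- On the support, (log f)'' plus the squared score is f''/f, whose mean is the integral of f'',
  -- namely zero.
  rw [eq_neg_iff_add_eq_zero, fisherInfo, ← integral_add hq hs, integral_law hf hθ₀,
    ← integral_iteratedDeriv_two_eq_zero hΘ hf hR2 hθ₀]
  congr 1; ext x
  by_cases hx : 0 < f θ₀ x
  · rw [iteratedDeriv_two_log_density hΘ hf hR2 hθ₀ hx, sub_add_cancel,
      mul_div_cancel₀ _ hx.ne']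
  · rw [iteratedDeriv_eq_zero_of_notMem_support hΘ hf hθ₀ hx,
      le_antisymm (not_lt.1 hx) (hf.nonneg θ₀ hθ₀ x), zero_mul]

/-! ### The log-likelihood of a sample and its expansion. -/

variable {n : ℕ} {x : Fin n → ℝ}

lemma iteratedDeriv_logLikelihood (hΘ : IsOpen Θ) (hf : IsDensityFamily ν Θ f) (hR2 : R2 ν Θ f)
    (hθ₀ : θ₀ ∈ Θ) (hx : x ∈ dataSupport n f θ₀) {k : ℕ} (hk : k ≤ 3) :
    iteratedDeriv k (fun t => logLikelihood f t x) θ₀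
      = ∑ i, iteratedDeriv k (fun t => Real.log (f t (x i))) θ₀ := by
  have he : (fun t => logLikelihood f t x) =ᶠ[𝓝 θ₀]
      fun t => ∑ i, Real.log (f t (x i)) := by
    filter_upwards [hΘ.mem_nhds hθ₀] with t ht
    exact Real.log_prod fun i _ => (hf.common_support θ₀ hθ₀ t ht _ (hx i)).ne'
  rw [he.iteratedDeriv_eq, iteratedDeriv_fun_sum]
  intro i _
  refine ((contDiffOn_log hf hR2 hθ₀ (hx i)).contDiffAt (hΘ.mem_nhds hθ₀)).of_le ?_
  exact_mod_cast hk

lemma deriv_logLikelihood_eq_zero (hΘ : IsOpen Θ) (hf : IsDensityFamily ν Θ f)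
    (hθ₀ : θ₀ ∈ Θ) (hx : x ∈ dataSupport n f θ₀) {T : ℝ} (hT : IsUniqueMLE Θ f x T) :
    deriv (fun t => logLikelihood f t x) T = 0 := by
  refine IsLocalMax.deriv_eq_zero ?_
  filter_upwards [hΘ.mem_nhds hT.1] with t ht
  refine Real.log_le_log (Finset.prod_pos fun i _ => hf.common_support θ₀ hθ₀ t ht _ (hx i)) ?_
  by_cases h : t = T
  · rw [h]
  · exact (hT.2 t ht h).le

/-- A monotonic function on a segment is at most the larger of its end values. Applied to M, this
leaves only θ₀ and the estimator, the two points where moments are assumed. -/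
lemma le_abs_add_abs_of_monotoneOn_or_antitoneOn {m : ℝ → ℝ} (hΘ : Θ.OrdConnected)
    (hm : MonotoneOn m Θ ∨ AntitoneOn m Θ) {a b c : ℝ} (ha : a ∈ Θ) (hb : b ∈ Θ)
    (hc : c ∈ uIcc a b) : m c ≤ |m a| + |m b| := by
  have hcΘ := hΘ.uIcc_subset ha hb hc
  have h1 := le_abs_self (m a)
  have h2 := le_abs_self (m b)
  have h3 := abs_nonneg (m a)
  have h4 := abs_nonneg (m b)
  rcases mem_uIcc.1 hc with ⟨h, h'⟩ | ⟨h, h'⟩ <;> rcases hm with hm | hm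
  · linarith [hm hcΘ hb h']
  · linarith [hm ha hcΘ h]
  · linarith [hm hcΘ ha h']
  · linarith [hm hb hcΘ h]

end Model

/-- The deterministic expansion of the score equation around the true parameter. -/
lemma abs_score_add_le {Ω : Type*} [MeasurableSpace Ω] {P : Measure Ω} {ν : Measure ℝ}
    {Θ : Set ℝ} (hΘ : IsOpen Θ) (hΘ' : Θ.OrdConnected) {f : ℝ → ℝ → ℝ}
    (hf : IsDensityFamily ν Θ f) (hR2 : R2 ν Θ f) {θ₀ : ℝ} (hθ₀ : θ₀ ∈ Θ) {n : ℕ}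
    {X : Fin n → Ω → ℝ} {est : (Fin n → ℝ) → ℝ} {M : ℝ → (Fin n → ℝ) → ℝ}
    (hRC4 : RC4'' P X Θ f θ₀ est M) {x : Fin n → ℝ} (hx : x ∈ dataSupport n f θ₀) {T : ℝ}
    (hT : IsUniqueMLE Θ f x T) :
    |(∑ i, deriv (fun t => Real.log (f t (x i))) θ₀)
        + (T - θ₀) * ∑ i, iteratedDeriv 2 (fun t => Real.log (f t (x i))) θ₀|
      ≤ (T - θ₀) ^ 2 / 2 * (|M θ₀ x| + |M T x|) := by
  have hsub := hΘ'.uIcc_subset hθ₀ hT.1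
  have hd : ∀ k < 3, ∀ c ∈ uIcc θ₀ T, HasDerivAt
      (iteratedDeriv k fun t => logLikelihood f t x)
      (iteratedDeriv (k + 1) (fun t => logLikelihood f t x) c) c := by
    intro k hk c hc
    rw [iteratedDeriv_succ]
    exact ((hRC4.differentiableOn x hx k hk).differentiableAt
      (hΘ.mem_nhds (hsub hc))).hasDerivAt
  have := abs_taylor_two_le (hd 1 (by norm_num)) (hd 2 (by norm_num))
    (K := |M θ₀ x| + |M T x|) fun c hc => (hRC4.abs_le x hx c (hsub hc)).trans
      (le_abs_add_abs_of_monotoneOn_or_antitoneOn (m := fun θ => M θ x) hΘ'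
        (hRC4.monotonic x hx) hθ₀ hT.1 hc)
  rw [iteratedDeriv_logLikelihood hΘ hf hR2 hθ₀ hx (by norm_num),
    iteratedDeriv_logLikelihood hΘ hf hR2 hθ₀ hx (by norm_num), iteratedDeriv_one,
    deriv_logLikelihood_eq_zero hΘ hf hθ₀ hx hT, ← abs_neg] at this
  simp only [iteratedDeriv_one] at this
  refine le_trans (le_of_eq ?_) this
  congr 1; ring

end

end SingleParamMLE

/-! ### Combining the score expansion with the central limit theorem. -/

theorem theorem3p2
    {Ω : Type*} [MeasurableSpace Ω] (P : Measure Ω) [IsProbabilityMeasure P]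
    -- the model: densities with respect to `ν`, indexed by an open interval `Θ`
    (ν : Measure ℝ) (Θ : Set ℝ) (hΘ_open : IsOpen Θ) (hΘ_interval : Θ.OrdConnected)
    (f : ℝ → ℝ → ℝ) (hf : SingleParamMLE.IsDensityFamily ν Θ f)
    (θ₀ : ℝ) (hθ₀ : θ₀ ∈ Θ)
    -- the i.i.d. sample `X₁, …, Xₙ`, `n ≥ 1`, from the density `f θ₀`
    (n : ℕ) [NeZero n] (X : Fin n → Ω → ℝ)
    (hX_indep : iIndepFun X P)
    (hX_law : ∀ i, HasLaw (X i) (SingleParamMLE.law ν f θ₀) P)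
    -- the maximum likelihood estimator exists and is unique
    (est : (Fin n → ℝ) → ℝ)
    (hest_meas : AEMeasurable (fun ω => est fun i => X i ω) P)
    (hest : ∀ᵐ ω ∂P, SingleParamMLE.IsUniqueMLE Θ f (fun i => X i ω) (est fun i => X i ω))
    -- regularity conditions
    (hR1 : SingleParamMLE.R1 ν Θ f) (hR2 : SingleParamMLE.R2 ν Θ f)
    (hR3 : SingleParamMLE.R3 ν f θ₀)
    (M : ℝ → (Fin n → ℝ) → ℝ)
    (hRC4 : SingleParamMLE.RC4'' P X Θ f θ₀ est M)
    -- moment conditions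
    (hscore : Integrable (fun ω => |deriv (fun t => Real.log (f t (X 0 ω))) θ₀| ^ 3) P)
    (hvar : MemLp (fun ω => iteratedDeriv 2 (fun t => Real.log (f t (X 0 ω))) θ₀) 2 P)
    (hmse : Integrable (fun ω => (est (fun i => X i ω) - θ₀) ^ 2) P) :
    SingleParamMLE.wassersteinDist
        (P.map fun ω => Real.sqrt (n * SingleParamMLE.fisherInfo ν f θ₀) *
          (est (fun i => X i ω) - θ₀))
        (gaussianReal 0 1) ≤
      ENNReal.ofReal (1 / Real.sqrt n *
        (2 + 1 / SingleParamMLE.fisherInfo ν f θ₀ ^ (3 / 2 : ℝ) *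
            (∫ ω, |deriv (fun t => Real.log (f t (X 0 ω))) θ₀| ^ 3 ∂P)
          + 1 / Real.sqrt (SingleParamMLE.fisherInfo ν f θ₀) *
            Real.sqrt (n * Var[fun ω => iteratedDeriv 2 (fun t => Real.log (f t (X 0 ω))) θ₀; P]) *
            Real.sqrt (∫ ω, (est (fun i => X i ω) - θ₀) ^ 2 ∂P)
          + 1 / (2 * Real.sqrt (SingleParamMLE.fisherInfo ν f θ₀)) *
            ((∫ ω, |(est (fun i => X i ω) - θ₀) ^ 2 * M θ₀ (fun i => X i ω)| ∂P)
              + ∫ ω, |(est (fun i => X i ω) - θ₀) ^ 2 *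
                  M (est fun i => X i ω) (fun i => X i ω)| ∂P))) := by

  set I := SingleParamMLE.fisherInfo ν f θ₀ with hI
  set s : ℝ → ℝ := fun x => deriv (fun t => Real.log (f t x)) θ₀ with hs
  set q : ℝ → ℝ := fun x => iteratedDeriv 2 (fun t => Real.log (f t x)) θ₀ with hq
  set μ := SingleParamMLE.law ν f θ₀ with hμ
  have hn : (0 : ℝ) < n := Nat.cast_pos.2 (Nat.pos_of_ne_zero (NeZero.ne n))
  have hI0 : 0 < I := lt_of_le_of_ne (integral_nonneg fun x => sq_nonneg _) (Ne.symm hR3)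
  have hnI : 0 < n * I := mul_pos hn hI0
  have hXm : ∀ i, AEMeasurable (X i) P := fun i => (hX_law i).aemeasurable
  have hsm : AEMeasurable s μ := SingleParamMLE.aemeasurable_score hΘ_open hf hR2 hθ₀
  have hqm : AEMeasurable q μ :=
    SingleParamMLE.aemeasurable_iteratedDeriv_two_log hΘ_open hf hR2 hθ₀
  have hint : ∀ {g : ℝ → ℝ}, AEMeasurable g μ → ∀ i, ∫ ω, g (X i ω) ∂P = ∫ x, g x ∂μ :=
    fun hg i => (hX_law i).integral_comp hg.aestronglyMeasurable
  have hmemLp : ∀ {g : ℝ → ℝ} {p : ENNReal}, AEMeasurable g μ → ∀ i,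
      (MemLp g p μ ↔ MemLp (fun ω => g (X i ω)) p P) := fun {g p} hg i => by
    rw [← (hX_law i).map_eq] at hg ⊢
    exact memLp_map_measure_iff hg.aestronglyMeasurable (hXm i)
  have hs3 : MemLp s 3 μ := by
    rw [hmemLp hsm 0, ← integrable_norm_rpow_iff _ (by norm_num) (by norm_num)]
    · simpa using hscore
    · rw [← (hX_law 0).map_eq] at hsm
      exact (hsm.comp_aemeasurable (hXm 0)).aestronglyMeasurable
  have hq2 : MemLp q 2 μ := (hmemLp hqm 0).2 hvar
  have : IsProbabilityMeasure μ := (hX_law 0).map_eq ▸ Measure.isProbabilityMeasure_map (hXm 0)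
  have hs2 : Integrable (fun x => s x ^ 2) μ := (hs3.mono_exponent (by norm_num)).integrable_sq
  have hsmean : ∫ x, s x ∂μ = 0 := SingleParamMLE.integral_score hΘ_open hf hR2 hθ₀
  have hqmean : ∫ x, q x ∂μ = -I := SingleParamMLE.integral_iteratedDeriv_two_log hΘ_open hf hR2
    hθ₀ hs2 (hq2.integrable (by norm_num))
  -- the normalised score is close to the standard Gaussian law
  have hsind : iIndepFun (fun i ω => s (X i ω)) P :=
    hX_indep.comp₀ (fun _ => s) hXm fun i => by rwa [(hX_law i).map_eq]
  have hqind : iIndepFun (fun i ω => q (X i ω)) P :=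
    hX_indep.comp₀ (fun _ => q) hXm fun i => by rwa [(hX_law i).map_eq]
  have hqX : ∀ i, MemLp (fun ω => q (X i ω)) 2 P := fun i => (hmemLp hqm i).1 hq2
  -- the fluctuation of the observed information
  set D : Ω → ℝ := fun ω => est (fun i => X i ω) - θ₀ with hD
  set A : Ω → ℝ := fun ω => ∑ i, s (X i ω) with hA
  set B : Ω → ℝ := fun ω => ∑ i, q (X i ω) with hB
  have hDm : AEMeasurable D P := hest_meas.sub_const θ₀
  have hD2 : MemLp D 2 P := (memLp_two_iff_integrable_sq hDm.aestronglyMeasurable).2 hmse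
  have hAi : Integrable A P := integrable_finsetSum _ fun i _ =>
    ((hmemLp hsm i).1 hs3).integrable (by norm_num)
  have hB2 : MemLp B 2 P := memLp_finsetSum _ fun i _ => hqX i
  have hBmean : ∫ ω, B ω ∂P = -(n * I) := by
    rw [hB, integral_finsetSum _ fun i _ => (hqX i).integrable (by norm_num)]
    simp only [hint hqm, hqmean]
    simp
  have hBvar : ∫ ω, (B ω + n * I) ^ 2 ∂P = n * Var[fun ω => q (X 0 ω); P] := by
    have h1 : Var[B; P] = ∫ ω, (B ω + n * I) ^ 2 ∂P := by
      rw [variance_eq_integral hB2.aestronglyMeasurable.aemeasurable, hBmean]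
      simp only [sub_neg_eq_add]
    have h2 : B = ∑ i, fun ω => q (X i ω) := by ext ω; simp [hB]
    have h3 : ∀ i, Var[fun ω => q (X i ω); P] = Var[q; μ] := fun i => by
      rw [← (hX_law i).map_eq] at hqm ⊢
      exact (variance_map hqm (hXm i)).symm
    rw [← h1, h2, IndepFun.variance_sum (fun i _ => hqX i) fun i _ j _ hij => hqind.indepFun hij]
    simp only [h3]
    simp
  have hBI : MemLp (fun ω => B ω + n * I) 2 P := hB2.add (memLp_const _)
  have hCS : ∫ ω, |D ω| * |B ω + n * I| ∂P
      ≤ √(∫ ω, D ω ^ 2 ∂P) * √(n * Var[fun ω => q (X 0 ω); P]) := by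
    rw [← hBvar]
    exact SingleParamMLE.integral_abs_mul_abs_le hD2 hBI
  set m₀ : Ω → ℝ := fun ω => D ω ^ 2 * M θ₀ (fun i => X i ω) with hm₀
  set m₁ : Ω → ℝ := fun ω => D ω ^ 2 * M (est fun i => X i ω) (fun i => X i ω) with hm₁
  have hm₀i : Integrable m₀ P := hRC4.integrable_true
  have hm₁i : Integrable m₁ P := hRC4.integrable_est
  -- An integrable majorant for the distance between the standardised estimator and the normalised
  -- score.
  set R : Ω → ℝ := fun ω =>
    1 / √(n * I) * (|D ω| * |B ω + n * I| + 1 / 2 * (|m₀ ω| + |m₁ ω|)) with hR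
  have hDB : Integrable (fun ω => |D ω| * |B ω + n * I|) P := hD2.norm.integrable_mul hBI.norm
  have hmm : Integrable (fun ω => |m₀ ω| + |m₁ ω|) P := hm₀i.norm.add hm₁i.norm
  have hRi : Integrable R P := (hDB.add (hmm.const_mul (1 / 2))).const_mul _
  have hWS : ∀ᵐ ω ∂P, |√(n * I) * D ω - A ω / √(n * I)| ≤ R ω := by
    have hsupp : ∀ᵐ ω ∂P, ∀ i, 0 < f θ₀ (X i ω) := by
      rw [ae_all_iff]
      intro i
      refine ae_of_ae_map (hXm i) (p := fun x => 0 < f θ₀ x) ?_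
      rw [(hX_law i).map_eq]
      exact SingleParamMLE.ae_law_of_forall hf hθ₀ fun x hx => hx
    filter_upwards [hest, hsupp] with ω hT hx
    have h1 : |A ω + D ω * B ω| ≤ D ω ^ 2 / 2 * (|M θ₀ fun i => X i ω|
        + |M (est fun i => X i ω) fun i => X i ω|) :=
      SingleParamMLE.abs_score_add_le hΘ_open hΘ_interval hf hR2 hθ₀ hRC4 hx hT
    have hr : 0 < √(n * I) := Real.sqrt_pos.2 hnI
    -- Adding and subtracting D B separates the fluctuation of B about its mean −nI from the Taylor
    -- remainder A + D B.
    have h2 : √(n * I) * D ω - A ω / √(n * I)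
        = 1 / √(n * I) * (D ω * (B ω + n * I) - (A ω + D ω * B ω)) := by
      have := Real.mul_self_sqrt hnI.le
      field_simp
      rw [Real.sq_sqrt hnI.le]
      ring
    rw [h2, abs_mul, abs_of_pos (one_div_pos.2 hr)]
    refine mul_le_mul_of_nonneg_left ((abs_sub _ _).trans (add_le_add ?_ (h1.trans ?_)))
      (one_div_pos.2 hr).le
    · rw [abs_mul]
    · simp only [hm₀, hm₁, abs_mul, abs_of_nonneg (sq_nonneg (D ω))]
      exact le_of_eq (by ring)
  have hintR : ∫ ω, R ω ∂P ≤ 1 / √(n * I) *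
      (√(∫ ω, D ω ^ 2 ∂P) * √(n * Var[fun ω => q (X 0 ω); P])
        + 1 / 2 * ((∫ ω, |m₀ ω| ∂P) + ∫ ω, |m₁ ω| ∂P)) := by
    have : ∫ ω, R ω ∂P = 1 / √(n * I) * ((∫ ω, |D ω| * |B ω + n * I| ∂P)
        + 1 / 2 * ((∫ ω, |m₀ ω| ∂P) + ∫ ω, |m₁ ω| ∂P)) := by
      rw [← integral_add hm₀i.abs hm₁i.abs, ← integral_const_mul,
        ← integral_add hDB (hmm.const_mul (1 / 2)), ← integral_const_mul]
    rw [this]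
    gcongr
  refine iSup₂_le fun h hL => ENNReal.ofReal_le_ofReal ?_
  have hclt := SingleParamMLE.abs_integral_comp_normalized_sum_sub_le (v := I)
    (ρ := ∫ ω, |s (X 0 ω)| ^ 3 ∂P) hsind (fun i => (hmemLp hsm i).1 hs3)
    (fun i => (hint hsm i).trans hsmean) hI0
    (fun i => hint (g := fun x => s x ^ 2) (hsm.pow_const 2) i)
    (fun i => (hint (g := fun x => |s x| ^ 3) (hsm.abs.pow_const 3) i).trans
      (hint (g := fun x => |s x| ^ 3) (hsm.abs.pow_const 3) 0).symm) hL
  have hL' : ∀ u v, |h u - h v| ≤ 1 * |u - v| := fun u v => by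
    simpa [Real.dist_eq] using hL.dist_le_mul u v
  have hWi : Integrable (fun ω => h (√(n * I) * D ω)) P :=
    SingleParamMLE.integrable_comp_of_abs_sub_le hL' ((hD2.integrable (by norm_num)).const_mul _)
  have hSi : Integrable (fun ω => h (A ω / √(n * I))) P :=
    SingleParamMLE.integrable_comp_of_abs_sub_le hL' (hAi.div_const _)
  have hrem : |(∫ ω, h (√(n * I) * D ω) ∂P) - ∫ ω, h (A ω / √(n * I)) ∂P| ≤ ∫ ω, R ω ∂P := by
    rw [← integral_sub hWi hSi]
    refine norm_integral_le_of_norm_le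
      (f := fun ω => h (√(n * I) * D ω) - h (A ω / √(n * I))) hRi ?_
    filter_upwards [hWS] with ω hω
    exact ((hL' _ _).trans_eq (one_mul _)).trans hω
  rw [integral_map (hDm.const_mul _) hL.continuous.aestronglyMeasurable]
  -- Triangle inequality through the law of the normalised score.
  refine (abs_sub_le _ (∫ ω, h (A ω / √(n * I)) ∂P) _).trans
    ((add_le_add (hrem.trans hintR) hclt).trans (le_of_eq ?_))
  have hsn : 0 < √(n : ℝ) := Real.sqrt_pos.2 hn
  have hsI : 0 < √I := Real.sqrt_pos.2 hI0
  rw [Real.sqrt_mul hn.le]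
  field_simp
  ring
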